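/- **Model.** There are $n$ suppliers, $N=\{1,\dots,n\}$. Let $\bar d\ge 0$, $\mathbf T=[0,\bar d]^n$ and $X(\mathbf t)=\{\mathbf s\in\mathbb R_+^n:\mathbf s\le\mathbf t\}$ for $\mathbf t\in\mathbf T$. The demand $D$ is random with values in a set $\mathcal D$. Let $V(D,\mathbf s)$ be the revenue of the buyer, and let $C_i(\mathbf s)$ and $E_i(\mathbf t)$ be the execution and reservation costs of supplier $i$, all real-valued, with $C_i(\mathbf s)=0$ if $s_i=0$ and $E_i(\mathbf t)=0$ if $t_i=0$. Assume that on $\mathbf T$ each $V(D,\cdot)$ is upper semicontinuous and the $C_i,E_i$ are lower semicontinuous, and that $$v(D,\mathbf t)=\max_{\mathbf s\in X(\mathbf t)}\Big(V(D,\mathbf s)-\sum_{i=1}^n C_i(\mathbf s)\Big)$$ has a finite expectation for every $\mathbf t\in\mathbf T$. For $S\subseteq N$ let $$\Pi^*_{\mathcal C}(S)=\max\ \mathbb E\Big[V(D,\mathbf s(D))-\sum_{i=1}^n\big(C_i(\mathbf s(D))+E_i(\mathbf t)\big)\Big],$$ the maximum being over all $\mathbf t\in\mathbf T$ with $t_i=0$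 for $i\notin S$ and all functions $\mathbf s:\mathcal D\to\mathbf T$ with $\mathbf s(D)\in X(\mathbf t)$ for all $D\in\mathcal D$ for which this expectation exists and is finite. A non-empty family $\mathcal L$ of subsets of $N$ is *laminar* if any two of its members are disjoint or nested. The function $v$ is *laminar concave in $\mathbf t$* if there is a laminar family $\mathcal L$, the same for all $D$, such that for every $D$ there are univariate concave functions $g_{A,D}$ ($A\in\mathcal L$), defined on $[0,|A|\bar d]$, with $v(D,\mathbf t)=\sum_{A\in\mathcal L}g_{A,D}\big(\sum_{i\in A}t_i\big)$ for all $\mathbf t\in\mathbf T$. **Theorem (Submodularity).** (1) If $v(D,\mathbf t)$ is laminar concave in $\mathbf t$ and each $E_i(\mathbf t)$ is a convex function of the $i$-th component of $\mathbf t$ only, then the maxima $\Pi^*_{\mathcal C}(S)$ exist and $\Pi^*_{\mathcal C}$ is submodular: for all $S\subseteq N$ and all $i,j\in S$ with $i\neq j$, $$\Pi^*_{\mathcal C}(S)-\Pi^*_{\mathcal C}(S\setminus\{i\})\le \Pi^*_{\mathcal C}(S\setminus\{j\})-\Pi^*_{\mathcal C}(S\setminus\{i,j\}).$$ (2) Consider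 the capacity game with function bids: $D$ has a probability distribution on $\mathcal D=[\underline d,\bar d]$, $0\le\underline d<\bar d$, and $$V(D,\mathbf s)=\rho\min\Big(D,\sum_{i=1}^n s_i\Big),\qquad C_i(\mathbf s)=\int_0^{s_i}c_i(u)\,du,\qquad E_i(\mathbf t)=\int_0^{t_i}e_i(u)\,du,$$ with unit revenue $\rho\ge0$ and non-negative marginal costs $c_i,e_i$ integrable on $[0,\bar d]$. If for each supplier the marginal execution cost $c_i$ is constant and the marginal reservation cost $e_i$ is non-decreasing on $[0,\bar d]$, then all the assumptions of the model and both conditions of (1) are satisfied; in particular $\Pi^*_{\mathcal C}(S)$ is submodular in $S\subseteq N$. -/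

import Mathlib

open MeasureTheory

noncomputable section

/-- The sum `x(A) = ∑_{i ∈ A} x_i`. -/
def partialSum {n : ℕ} (A : Finset (Fin n)) (x : Fin n → ℝ) : ℝ := ∑ i ∈ A, x i

/-- A non-empty family of subsets of `{1, …, n}`, any two of which are disjoint or nested. -/
def IsLaminarFamily {n : ℕ} (L : Finset (Finset (Fin n))) : Prop :=
  L.Nonempty ∧ ∀ A ∈ L, ∀ B ∈ L, A ∩ B = ∅ ∨ A ⊆ B ∨ B ⊆ A

/-- `f(x) = ∑_{A ∈ L} g_A(x(A))` for all `x ∈ T`, with univariate concave functions `g_A`.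
Each `g_A` has to be (finite and) concave on the set of values that `x(A)` takes for `x ∈ T`. -/
def LaminarConcaveOn {n : ℕ} (L : Finset (Finset (Fin n))) (T : Set (Fin n → ℝ))
    (f : (Fin n → ℝ) → ℝ) : Prop :=
  ∃ g : Finset (Fin n) → ℝ → ℝ,
    (∀ A ∈ L, ConcaveOn ℝ (partialSum A '' T) (g A)) ∧
    ∀ x ∈ T, f x = ∑ A ∈ L, g A (partialSum A x)

/-- Submodularity of a set function: decreasing marginal contributions. -/
def IsSubmodular {n : ℕ} (f : Finset (Fin n) → ℝ) : Prop :=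
  ∀ (S : Finset (Fin n)) (i j : Fin n), i ∈ S → j ∈ S → i ≠ j →
    f S - f (S \ {i}) ≤ f (S \ {j}) - f (S \ {i, j})

/-- The data of a capacity game with `n` suppliers, capacity sets `[0, dbar]` and demand set `𝒟`
that matter for the supply chain profit (which does not depend on the bids). -/
structure CapacityGame (n : ℕ) (𝒟 : Type*) [MeasurableSpace 𝒟] where
  /-- the distribution of the demand `D` -/
  law : Measure 𝒟
  /-- the largest capacity that can be reserved from a supplier -/
  dbar : ℝ
  /-- the revenue `V(D, s)` of the buyer -/
  V : 𝒟 → (Fin n → ℝ) → ℝ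
  /-- the execution cost `C_i(s)` of supplier `i` -/
  C : Fin n → (Fin n → ℝ) → ℝ
  /-- the reservation cost `E_i(t)` of supplier `i` -/
  E : Fin n → (Fin n → ℝ) → ℝ

namespace CapacityGame

variable {n : ℕ} {𝒟 : Type*} [MeasurableSpace 𝒟] (G : CapacityGame n 𝒟)

/-- The set `[0, dbar]^n` of capacity decisions. -/
def T : Set (Fin n → ℝ) := {t | ∀ i, 0 ≤ t i ∧ t i ≤ G.dbar}

/-- The execution quantities that are possible once the capacities `t` are reserved. -/
def X (_G : CapacityGame n 𝒟) (t : Fin n → ℝ) : Set (Fin n → ℝ) :=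
  {s | ∀ i, 0 ≤ s i ∧ s i ≤ t i}

/-- The profit of the supply chain under demand `d`, reservation `t` and execution `s`. -/
def realizedProfit (d : 𝒟) (t s : Fin n → ℝ) : ℝ :=
  G.V d s - ∑ i, (G.C i s + G.E i t)

/-- The expected supply chain profit of a policy, a reservation `t` together with an execution
vector `s(D)` for every demand `D`. -/
def channelProfit (t : Fin n → ℝ) (s : 𝒟 → Fin n → ℝ) : ℝ :=
  ∫ d, G.realizedProfit d t (s d) ∂G.law

/-- The policies that reserve capacity from suppliers in `S` only and have an expected profit. -/
def IsPolicy (S : Finset (Fin n)) (t : Fin n → ℝ) (s : 𝒟 → Fin n → ℝ) : Prop :=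
  t ∈ G.T ∧ (∀ i, 0 < t i → i ∈ S) ∧ (∀ d, s d ∈ G.X t) ∧
    Integrable (fun d => G.realizedProfit d t (s d)) G.law

/-- The expected supply chain profits of all policies restricted to `S`. -/
def attainableProfits (S : Finset (Fin n)) : Set ℝ :=
  {p | ∃ t s, G.IsPolicy S t s ∧ p = G.channelProfit t s}

/-- The optimal supply chain profit when only the suppliers in `S` are available. -/
def optProfit (S : Finset (Fin n)) : ℝ := sSup (G.attainableProfits S)

/-- The optimal second stage value `max_{s ∈ X(t)} (V(d, s) - ∑ C_i(s))`. -/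
def stageValue (d : 𝒟) (t : Fin n → ℝ) : ℝ :=
  sSup ((fun s => G.V d s - ∑ i, G.C i s) '' G.X t)

/-- The standing assumptions of the model. The semicontinuity conditions make the maxima exist;
the last condition says that the expectation of the optimal second stage value exists. -/
structure StandingAssumptions : Prop where
  isProbabilityMeasure : IsProbabilityMeasure G.law
  dbar_nonneg : 0 ≤ G.dbar
  C_eq_zero : ∀ i, ∀ s ∈ G.T, s i = 0 → G.C i s = 0
  E_eq_zero : ∀ i, ∀ t ∈ G.T, t i = 0 → G.E i t = 0
  upperSemicontinuous_V : ∀ d, UpperSemicontinuousOn (G.V d) G.T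
  lowerSemicontinuous_C : ∀ i, LowerSemicontinuousOn (G.C i) G.T
  lowerSemicontinuous_E : ∀ i, LowerSemicontinuousOn (G.E i) G.T
  integrable_stageValue : ∀ t ∈ G.T, Integrable (fun d => G.stageValue d t) G.law

/-- The optimal second stage value is laminar concave in `t ∈ T`, with one laminar family for
all demands (the univariate concave functions may depend on the demand). -/
def StageValueLaminarConcave : Prop :=
  ∃ L : Finset (Finset (Fin n)), IsLaminarFamily L ∧ ∀ d, LaminarConcaveOn L G.T (G.stageValue d)

/-- Every `E_i(t)` is a convex function of the `i`-th component of `t` only. -/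
def ReservationCostsConvex : Prop :=
  ∀ i, ∃ φ : ℝ → ℝ, ConvexOn ℝ (Set.Icc 0 G.dbar) φ ∧ ∀ t ∈ G.T, G.E i t = φ (t i)

end CapacityGame

/-- The data of a capacity game with function bids: demand in `[dlow, dbar]`, a revenue `ρ` per
unit sold and, for every supplier, marginal execution and reservation costs `c_i` and `e_i`
(non-negative, as the total costs are increasing). -/
structure FunctionBidGame (n : ℕ) where
  dlow : ℝ
  dbar : ℝ
  dlow_nonneg : 0 ≤ dlow
  dlow_lt_dbar : dlow < dbar
  /-- the distribution of the demand -/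
  law : Measure (Set.Icc dlow dbar)
  isProbabilityMeasure : IsProbabilityMeasure law
  ρ : ℝ
  ρ_nonneg : 0 ≤ ρ
  c : Fin n → ℝ → ℝ
  e : Fin n → ℝ → ℝ
  c_nonneg : ∀ i, ∀ u ∈ Set.Icc 0 dbar, 0 ≤ c i u
  e_nonneg : ∀ i, ∀ u ∈ Set.Icc 0 dbar, 0 ≤ e i u
  c_integrable : ∀ i, IntervalIntegrable (c i) volume 0 dbar
  e_integrable : ∀ i, IntervalIntegrable (e i) volume 0 dbar

/-- The capacity game with function bids as a capacity game. -/
def FunctionBidGame.toCapacityGame {n : ℕ} (B : FunctionBidGame n) :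
    CapacityGame n (Set.Icc B.dlow B.dbar) where
  law := B.law
  dbar := B.dbar
  V := fun d s => B.ρ * min (d : ℝ) (∑ i, s i)
  C := fun i s => ∫ u in (0 : ℝ)..(s i), B.c i u
  E := fun i t => ∫ u in (0 : ℝ)..(t i), B.e i u

end

/-! Submodularity is an exchange argument. Let `x` and `y` be optimal reservations for `S` and `S \
{i, j}`. Part of the difference `x - y`, a vector `w`, is moved from `x` to `y` so that `y + w`
avoids `i` and `x - w` avoids `j`; this means `w i = 0` and `w j = x j`. If moreover `w(A)` lies
between `0` and `(x - y)(A)` for every laminar member `A` and every singleton, then each pair of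
arguments of a concave `g_A` or `-E_i` moves closer together, so the total profit does not fall.
Such a `w` exists by `exists_laminar_split`: minimise `w i` under the remaining constraints; a
positive minimum could be lowered by `exists_exchange_of_laminar`.

Optimal reservations exist because the expected profit is upper semicontinuous (Fatou) on a compact
set.

For function bids with constant execution costs, suppliers are used in order of decreasing margin.
Summation by parts writes the greedy value as a non-negative combination of the functions `min d
(t(A))` over the chain of prefixes `A` of this order, and a chain is laminar. -/

/-! ### Exchange in laminar families -/

theorem partialSum_add {n : ℕ} (A : Finset (Fin n)) (x y : Fin n → ℝ) :
    partialSum A (x + y) = partialSum A x + partialSum A y := by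
  simp [partialSum, Finset.sum_add_distrib]

theorem partialSum_sub {n : ℕ} (A : Finset (Fin n)) (x y : Fin n → ℝ) :
    partialSum A (x - y) = partialSum A x - partialSum A y := by
  simp [partialSum]

theorem partialSum_singleton {n : ℕ} (i : Fin n) (x : Fin n → ℝ) :
    partialSum {i} x = x i := by
  simp [partialSum]

theorem partialSum_piSingle {n : ℕ} (A : Finset (Fin n)) (i : Fin n) (a : ℝ) :
    partialSum A (Pi.single i a) = if i ∈ A then a else 0 := by
  simp [partialSum]

theorem continuous_partialSum {n : ℕ} (A : Finset (Fin n)) : Continuous (partialSum A) := by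
  unfold partialSum; fun_prop

/-- A set that is a union of members of a laminar family, each of non-negative weight, has
non-negative weight. -/
theorem partialSum_nonneg_of_laminar_cover {n : ℕ} {L : Finset (Finset (Fin n))}
    (hL : ∀ A ∈ L, ∀ B ∈ L, A ∩ B = ∅ ∨ A ⊆ B ∨ B ⊆ A) (w : Fin n → ℝ)
    (R : Finset (Fin n))
    (hR : ∀ k ∈ R, ∃ B ∈ L, k ∈ B ∧ B ⊆ R ∧ 0 ≤ partialSum B w) :
    0 ≤ partialSum R w := by
  classical
  induction R using Finset.strongInduction with
  | H R ih =>
    rcases R.eq_empty_or_nonempty with rfl | ⟨k, hk⟩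
    · simp [partialSum]
    -- A largest `B` in `U` is split off. A member of `U` through a point outside `B` cannot contain
    -- `B`, by maximality, so it is disjoint from `B` and the cover survives on `R \ B`.
    let U := L.filter fun B => B.Nonempty ∧ B ⊆ R ∧ 0 ≤ partialSum B w
    have hU : U.Nonempty := by
      obtain ⟨B, hB, hkB, h⟩ := hR k hk
      exact ⟨B, Finset.mem_filter.2 ⟨hB, ⟨k, hkB⟩, h⟩⟩
    obtain ⟨B, hBU, hmax⟩ := U.exists_max_image Finset.card hU
    obtain ⟨hBL, hBne, hBR, hBw⟩ := Finset.mem_filter.1 hBU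
    have hrest : 0 ≤ partialSum (R \ B) w := by
      refine ih _ (Finset.sdiff_ssubset hBR hBne) fun m hm => ?_
      obtain ⟨hmR, hmB⟩ := Finset.mem_sdiff.1 hm
      obtain ⟨B', hB', hmB', hB'R, hB'w⟩ := hR m hmR
      refine ⟨B', hB', hmB', ?_, hB'w⟩
      rcases hL B hBL B' hB' with h | h | h
      · intro x hx
        refine Finset.mem_sdiff.2 ⟨hB'R hx, fun hxB => ?_⟩
        have : x ∈ B ∩ B' := Finset.mem_inter.2 ⟨hxB, hx⟩
        simp [h] at this
      · have h1 := hmax B' (Finset.mem_filter.2 ⟨hB', ⟨m, hmB'⟩, hB'R, hB'w⟩)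
        have := Finset.eq_of_subset_of_card_le h h1
        exact absurd (this ▸ hmB') hmB
      · exact absurd (h hmB') hmB
    have : partialSum R w = partialSum (R \ B) w + partialSum B w :=
      (Finset.sum_sdiff hBR).symm
    linarith

/-- If a vector respecting the bounds of a laminar family has a positive `i`-th entry, then this
entry can be decreased, possibly against an increase of another entry `k` that has not reached
its upper bound. -/
theorem exists_exchange_of_laminar {n : ℕ} {L : Finset (Finset (Fin n))}
    (hL : ∀ A ∈ L, ∀ B ∈ L, A ∩ B = ∅ ∨ A ⊆ B ∨ B ⊆ A) (lo hi : Finset (Fin n) → ℝ)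
    (hlo : ∀ A, lo A ≤ 0) (hhi : ∀ A, 0 ≤ hi A) (w : Fin n → ℝ) {i : Fin n} (hi0 : 0 < w i)
    (hw : ∀ A ∈ L, partialSum A w ∈ Set.Icc (lo A) (hi A)) :
    ∃ u : Fin n → ℝ, u i < 0 ∧
      (∀ j, j ≠ i → {j} ∈ L → partialSum {j} w = hi {j} → u j = 0) ∧
      ∀ A ∈ L, (0 < partialSum A u → partialSum A w < hi A) ∧
        (partialSum A u < 0 → lo A < partialSum A w) := by
  classical
  -- Only these members block lowering entry `i` alone.
  let Tight := L.filter fun A => i ∈ A ∧ partialSum A w = lo A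
  rcases Tight.eq_empty_or_nonempty with hT | hT
  · refine ⟨Pi.single i (-1), by simp, fun j hj _ _ => by simp [hj], fun A hA => ?_⟩
    rw [partialSum_piSingle]
    split_ifs with h
    · refine ⟨by norm_num, fun _ => lt_of_le_of_ne (hw A hA).1 fun he => ?_⟩
      have : A ∈ Tight := Finset.mem_filter.2 ⟨hA, h, he.symm⟩
      simp [hT] at this
    · simp
  -- All tight members share `i`, so the smallest lies in every other one; raising an entry inside
  -- it compensates in all of them at once.
  obtain ⟨A, hAT, hmin⟩ := Tight.exists_min_image Finset.card hT
  obtain ⟨hAL, hiA, hAw⟩ := Finset.mem_filter.1 hAT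
  -- Otherwise members at their upper bounds, hence of non-negative weight, would cover `A \ {i}`,
  -- giving `w(A) ≥ w i > 0 ≥ lo A`, although `A` is tight.
  obtain ⟨k, hkA, hki, hk⟩ : ∃ k ∈ A, k ≠ i ∧
      ∀ B ∈ L, k ∈ B → i ∉ B → partialSum B w < hi B := by
    by_contra! hcon
    have hR : 0 ≤ partialSum (A \ {i}) w := by
      refine partialSum_nonneg_of_laminar_cover hL w _ fun k hk => ?_
      obtain ⟨hkA, hki⟩ := Finset.mem_sdiff.1 hk
      obtain ⟨B, hB, hkB, hiB, hBw⟩ := hcon k hkA (by simpa using hki)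
      refine ⟨B, hB, hkB, ?_, (hhi B).trans hBw⟩
      rcases hL A hAL B hB with h | h | h
      · have : k ∈ A ∩ B := Finset.mem_inter.2 ⟨hkA, hkB⟩
        simp [h] at this
      · exact absurd (h hiA) hiB
      · intro x hx
        refine Finset.mem_sdiff.2 ⟨h hx, ?_⟩
        rintro hxi
        exact hiB (Finset.mem_singleton.1 hxi ▸ hx)
    have h1 : partialSum A w = partialSum (A \ {i}) w + partialSum {i} w :=
      (Finset.sum_sdiff (Finset.singleton_subset_iff.2 hiA)).symm
    rw [partialSum_singleton] at h1
    linarith [hlo A]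
  refine ⟨Pi.single k 1 - Pi.single i 1, by simp [Ne.symm hki], fun j hj hjL hjw => ?_,
    fun B hB => ?_⟩
  · have : j ≠ k := by
      rintro rfl
      exact (hk {j} hjL (by simp) (by simpa using hki.symm)).ne hjw
    simp [hj, this]
  · rw [partialSum_sub, partialSum_piSingle, partialSum_piSingle]
    by_cases hkB : k ∈ B <;> by_cases hiB : i ∈ B
    · simp [hkB, hiB]
    · simpa [hkB, hiB, (zero_lt_one' ℝ).not_gt] using hk B hB hkB hiB
    · refine ⟨by simp [hkB, hiB], fun _ => ?_⟩
      refine lt_of_le_of_ne (hw B hB).1 fun he => ?_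
      have h1 := hmin B (Finset.mem_filter.2 ⟨hB, hiB, he.symm⟩)
      rcases hL A hAL B hB with h | h | h
      · have : i ∈ A ∩ B := Finset.mem_inter.2 ⟨hiA, hiB⟩
        simp [h] at this
      · exact hkB (h hkA)
      · exact hkB (Finset.eq_of_subset_of_card_le h h1 ▸ hkA)
    · simp [hkB, hiB]

/-- The bound towards which `u` points is not attained, so continuity leaves room for small steps;
the other bound is only moved away from. -/
theorem eventually_add_mul_mem_Icc {a b v u : ℝ} (hv : v ∈ Set.Icc a b) (hup : 0 < u → v < b)
    (hdown : u < 0 → a < v) : ∀ᶠ t in nhdsWithin (0 : ℝ) (Set.Ioi 0), v + t * u ∈ Set.Icc a b := by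
  have hc : Filter.Tendsto (fun t : ℝ => v + t * u) (nhdsWithin 0 (Set.Ioi 0)) (nhds v) := by
    have : Continuous fun t : ℝ => v + t * u := by fun_prop
    simpa using (this.tendsto 0).mono_left nhdsWithin_le_nhds
  rcases lt_trichotomy u 0 with h | h | h
  · filter_upwards [hc.eventually (lt_mem_nhds (hdown h)), self_mem_nhdsWithin] with t ht ht0
    exact ⟨ht.le, by nlinarith [hv.2, Set.mem_Ioi.1 ht0]⟩
  · simpa [h] using hv
  · filter_upwards [hc.eventually (gt_mem_nhds (hup h)), self_mem_nhdsWithin] with t ht ht0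
    exact ⟨by nlinarith [hv.1, Set.mem_Ioi.1 ht0], ht.le⟩

/-- Given a vector `δ` and a laminar family containing the singletons, there is a vector `w` with
`w i = 0` and `w j = δ j` such that `w(A)` lies between `0` and `δ(A)` for all members `A`. -/
theorem exists_laminar_split {n : ℕ} {L : Finset (Finset (Fin n))}
    (hL : ∀ A ∈ L, ∀ B ∈ L, A ∩ B = ∅ ∨ A ⊆ B ∨ B ⊆ A) (hsing : ∀ k, {k} ∈ L)
    (δ : Fin n → ℝ) {i j : Fin n} (hij : i ≠ j) (hi : 0 ≤ δ i) (hj : 0 ≤ δ j) :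
    ∃ w : Fin n → ℝ, w i = 0 ∧ w j = δ j ∧
      ∀ A ∈ L, partialSum A w ∈ Set.uIcc 0 (partialSum A δ) := by
  -- The singletons in `L` bound every coordinate, so `K` is compact; it contains `δ`.
  let K : Set (Fin n → ℝ) :=
    {w | w j = δ j ∧ ∀ A ∈ L, partialSum A w ∈ Set.uIcc 0 (partialSum A δ)}
  have hKc : IsCompact K := by
    have hbox : IsCompact (Set.univ.pi fun k => Set.uIcc 0 (δ k)) :=
      isCompact_univ_pi fun k => isCompact_uIcc
    refine hbox.of_isClosed_subset ?_ fun w hw k _ => ?_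
    · have : K = {w | w j = δ j} ∩ ⋂ A ∈ L, partialSum A ⁻¹' Set.uIcc 0 (partialSum A δ) := by
        ext w; simp [K]
      rw [this]
      refine (isClosed_eq (continuous_apply j) continuous_const).inter ?_
      exact isClosed_biInter fun A _ =>
        IsClosed.preimage (continuous_partialSum A) (by rw [Set.uIcc]; exact isClosed_Icc)
    · simpa [partialSum_singleton] using hw.2 {k} (hsing k)
  obtain ⟨w, hwK, hmin⟩ := hKc.exists_isMinOn ⟨δ, rfl, fun A _ => Set.right_mem_uIcc⟩
    (continuous_apply i).continuousOn
  refine ⟨w, ?_, hwK.1, hwK.2⟩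
  have hwi : 0 ≤ w i := by
    have := hwK.2 {i} (hsing i)
    rw [partialSum_singleton, partialSum_singleton, Set.uIcc_of_le hi] at this
    exact this.1
  by_contra hne
  obtain ⟨u, hui, huj, hu⟩ := exists_exchange_of_laminar hL
    (fun A => min 0 (partialSum A δ)) (fun A => max 0 (partialSum A δ))
    (fun A => min_le_left _ _) (fun A => le_max_left _ _) w (lt_of_le_of_ne hwi (Ne.symm hne))
    hwK.2
  have hev : ∀ᶠ t in nhdsWithin (0 : ℝ) (Set.Ioi 0), ∀ A ∈ L,
      partialSum A w + t * partialSum A u ∈ Set.uIcc 0 (partialSum A δ) :=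
    (Filter.eventually_all_finset L).2 fun A hA =>
      eventually_add_mul_mem_Icc (hwK.2 A hA) (hu A hA).1 (hu A hA).2
  obtain ⟨t, ht, ht0⟩ := (hev.and self_mem_nhdsWithin).exists
  -- Since `δ j ≥ 0`, the value `w j = δ j` is the upper bound of `{j}`, so the exchange leaves
  -- entry `j` fixed.
  have hj0 : u j = 0 := huj j hij.symm (hsing j) (by
    simp only [partialSum_singleton, hwK.1, max_eq_right hj])
  have hmem : w + t • u ∈ K := by
    refine ⟨by simp [hj0, hwK.1], fun A hA => ?_⟩
    have : partialSum A (t • u) = t * partialSum A u := by simp [partialSum, Finset.mul_sum]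
    rw [partialSum_add, this]
    exact ht A hA
  have h1 : w i ≤ (w + t • u) i := hmin hmem
  have : t * u i < 0 := mul_neg_of_pos_of_neg ht0 hui
  simp only [Pi.add_apply, Pi.smul_apply, smul_eq_mul] at h1
  linarith

/-! ### Concavity and Fatou's lemma -/

/-- Moving two arguments of a concave function towards each other increases the sum of its
values. -/
theorem ConcaveOn.add_le_add_of_mem_uIcc {s : Set ℝ} {g : ℝ → ℝ} (hg : ConcaveOn ℝ s g)
    {x y v : ℝ} (hx : x ∈ s) (hy : y ∈ s) (hv : v ∈ Set.uIcc 0 (x - y)) :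
    g x + g y ≤ g (y + v) + g (x - v) := by
  -- With `v = b (x - y)` and `a + b = 1`, the new points are the convex combinations of `x` and `y`
  -- with weights `(b, a)` and `(a, b)`.
  rw [← segment_eq_uIcc] at hv
  obtain ⟨a, b, ha, hb, hab, rfl⟩ := hv
  have h1 := hg.2 hx hy hb ha (by linarith)
  have h2 := hg.2 hx hy ha hb hab
  have e1 : y + (a • (0 : ℝ) + b • (x - y)) = b • x + a • y := by
    simp only [smul_eq_mul]; linear_combination (-y) * hab
  have e2 : x - (a • (0 : ℝ) + b • (x - y)) = a • x + b • y := by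
    simp only [smul_eq_mul]; linear_combination (-x) * hab
  rw [e1, e2]
  simp only [smul_eq_mul] at *
  have : g x + g y = (a + b) * g x + (a + b) * g y := by rw [hab]; ring
  linarith

/-- Fatou's lemma: the integral of upper semicontinuous functions with an integrable upper bound
is upper semicontinuous in the parameter. -/
theorem upperSemicontinuousOn_integral {Ω α : Type*} [MeasurableSpace Ω] {μ : Measure Ω}
    [TopologicalSpace α] [FirstCountableTopology α] {K : Set α} {F : Ω → α → ℝ} {b : Ω → ℝ}
    (hb : Integrable b μ) (hF : ∀ x ∈ K, Integrable (fun ω => F ω x) μ)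
    (hle : ∀ x ∈ K, ∀ ω, F ω x ≤ b ω) (husc : ∀ ω, UpperSemicontinuousOn (F ω) K) :
    UpperSemicontinuousOn (fun x => ∫ ω, F ω x ∂μ) K := by
  rw [← upperSemicontinuousOn_iff_restrict, upperSemicontinuous_iff]
  intro x
  rw [upperSemicontinuousAt_iff]
  intro y hxy
  simp only [Set.domRestrict_apply] at hxy
  have hint (z : K) : ∫⁻ ω, ENNReal.ofReal (b ω - F ω z) ∂μ =
      ENNReal.ofReal ((∫ ω, b ω ∂μ) - ∫ ω, F ω z ∂μ) := by
    rw [← integral_sub hb (hF z z.2)]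
    exact (ofReal_integral_eq_lintegral_ofReal (hb.sub (hF z z.2))
      (Filter.Eventually.of_forall fun ω => sub_nonneg.2 (hle z z.2 ω))).symm
  have hlsc (ω : Ω) : ENNReal.ofReal (b ω - F ω x) ≤
      Filter.liminf (fun z : K => ENNReal.ofReal (b ω - F ω z)) (nhds x) := by
    rw [← lowerSemicontinuousAt_iff_le_liminf (f := fun z : K => ENNReal.ofReal (b ω - F ω z))]
    refine ContinuousAt.comp_upperSemicontinuousAt_antitone
      (g := fun r : ℝ => ENNReal.ofReal (b ω - r)) (f := fun z : K => F ω z) ?_ ?_ ?_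
    · exact (ENNReal.continuous_ofReal.comp (by fun_prop)).continuousAt
    · exact upperSemicontinuousOn_iff_restrict.2 (husc ω) x
    · intro r r' h
      exact ENNReal.ofReal_le_ofReal (by linarith)
  have hfatou : ENNReal.ofReal ((∫ ω, b ω ∂μ) - ∫ ω, F ω x ∂μ) ≤
      Filter.liminf (fun z : K => ENNReal.ofReal ((∫ ω, b ω ∂μ) - ∫ ω, F ω z ∂μ)) (nhds x) := by
    simp only [← hint]
    exact (lintegral_mono hlsc).trans (lintegral_liminf_le' fun z : K =>
      (hb.sub (hF z z.2)).aestronglyMeasurable.aemeasurable.ennreal_ofReal)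
  -- Truncation by `ENNReal.ofReal` is harmless only if `y ≤ ∫ b`; otherwise the bound `b` settles
  -- the claim.
  by_cases hby : (∫ ω, b ω ∂μ) < y
  · exact Filter.Eventually.of_forall fun z =>
      (integral_mono (hF z z.2) hb (hle z z.2)).trans_lt hby
  · have h1 : ENNReal.ofReal ((∫ ω, b ω ∂μ) - y) <
        ENNReal.ofReal ((∫ ω, b ω ∂μ) - ∫ ω, F ω x ∂μ) :=
      (ENNReal.ofReal_lt_ofReal_iff_of_nonneg (by linarith)).2 (by linarith)
    filter_upwards [Filter.eventually_lt_of_lt_liminf (h1.trans_le hfatou)] with z hz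
    have := (ENNReal.ofReal_lt_ofReal_iff_of_nonneg (by linarith)).1 hz
    simp only [Set.domRestrict_apply]
    linarith

/-! ### Existence of optimal policies -/

namespace CapacityGame

variable {n : ℕ} {𝒟 : Type*} [MeasurableSpace 𝒟] {G : CapacityGame n 𝒟}

theorem X_eq_Icc (G : CapacityGame n 𝒟) (t : Fin n → ℝ) : G.X t = Set.Icc 0 t := by
  ext s
  simp [X, Set.mem_Icc, Pi.le_def, forall_and]

theorem T_eq_Icc (G : CapacityGame n 𝒟) : G.T = Set.Icc 0 (fun _ => G.dbar) := by
  ext s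
  simp [T, Set.mem_Icc, Pi.le_def, forall_and]

theorem isCompact_T (G : CapacityGame n 𝒟) : IsCompact G.T := by
  rw [T_eq_Icc]; exact isCompact_Icc

theorem isCompact_X (G : CapacityGame n 𝒟) (t : Fin n → ℝ) : IsCompact (G.X t) := by
  rw [X_eq_Icc]; exact isCompact_Icc

theorem X_subset_T {t : Fin n → ℝ} (ht : t ∈ G.T) : G.X t ⊆ G.T :=
  fun _ hs i => ⟨(hs i).1, (hs i).2.trans (ht i).2⟩

theorem zero_mem_X {t : Fin n → ℝ} (ht : t ∈ G.T) : 0 ∈ G.X t := fun i => ⟨le_rfl, (ht i).1⟩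

theorem upperSemicontinuousOn_sub_sum {α ι : Type*} [TopologicalSpace α] {K : Set α}
    {f : α → ℝ} {g : ι → α → ℝ} (s : Finset ι) (hf : UpperSemicontinuousOn f K)
    (hg : ∀ i, LowerSemicontinuousOn (g i) K) :
    UpperSemicontinuousOn (fun x => f x - ∑ i ∈ s, g i x) K := by
  have h := lowerSemicontinuousOn_sum (a := s) fun i _ => hg i
  have h2 := continuous_neg.comp_lowerSemicontinuousOn_antitone h fun _ _ h => neg_le_neg h
  simpa [sub_eq_add_neg] using hf.add h2

theorem StandingAssumptions.upperSemicontinuousOn_netRevenue (h : G.StandingAssumptions)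
    (d : 𝒟) : UpperSemicontinuousOn (fun s => G.V d s - ∑ i, G.C i s) G.T :=
  upperSemicontinuousOn_sub_sum _ (h.upperSemicontinuous_V d) h.lowerSemicontinuous_C

theorem StandingAssumptions.exists_isGreatest_stageValue (h : G.StandingAssumptions)
    (d : 𝒟) {t : Fin n → ℝ} (ht : t ∈ G.T) :
    ∃ s ∈ G.X t, G.stageValue d t = G.V d s - ∑ i, G.C i s ∧
      ∀ s' ∈ G.X t, G.V d s' - ∑ i, G.C i s' ≤ G.stageValue d t := by
  obtain ⟨s, hs, hmax⟩ := ((h.upperSemicontinuousOn_netRevenue d).mono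
    (X_subset_T ht)).exists_isMaxOn ⟨0, zero_mem_X ht⟩ (G.isCompact_X t)
  have hg : IsGreatest ((fun s => G.V d s - ∑ i, G.C i s) '' G.X t)
      (G.V d s - ∑ i, G.C i s) :=
    ⟨⟨s, hs, rfl⟩, by rintro _ ⟨s', hs', rfl⟩; exact hmax hs'⟩
  refine ⟨s, hs, hg.csSup_eq, fun s' hs' => ?_⟩
  rw [stageValue, hg.csSup_eq]
  exact hmax hs'

theorem StandingAssumptions.stageValue_mono (h : G.StandingAssumptions) (d : 𝒟)
    {t t' : Fin n → ℝ} (ht : t ∈ G.T) (ht' : t' ∈ G.T) (hle : t ≤ t') :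
    G.stageValue d t ≤ G.stageValue d t' := by
  obtain ⟨s, hs, hv, -⟩ := h.exists_isGreatest_stageValue d ht
  obtain ⟨-, -, -, hv'⟩ := h.exists_isGreatest_stageValue d ht'
  rw [hv]
  exact hv' s fun i => ⟨(hs i).1, (hs i).2.trans (hle i)⟩

/-- As the inner maximum is attained, each superlevel set is the projection of a compact set of
pairs `(s, t)`, hence closed. -/
theorem StandingAssumptions.upperSemicontinuousOn_stageValue (h : G.StandingAssumptions)
    (d : 𝒟) : UpperSemicontinuousOn (G.stageValue d) G.T := by
  rw [upperSemicontinuousOn_iff_preimage_Ici]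
  intro b
  let K : Set ((Fin n → ℝ) × (Fin n → ℝ)) :=
    ((G.T ∩ (fun s => G.V d s - ∑ i, G.C i s) ⁻¹' Set.Ici b) ×ˢ G.T) ∩
      {p | 0 ≤ p.1 ∧ p.1 ≤ p.2}
  have hK : IsCompact K := by
    refine IsCompact.inter_right (IsCompact.prod ?_ G.isCompact_T) ?_
    · exact (h.upperSemicontinuousOn_netRevenue d).isCompact_inter_preimage_Ici G.isCompact_T b
    · exact (isClosed_le continuous_const continuous_fst).inter
        (isClosed_le continuous_fst continuous_snd)
  refine ⟨Prod.snd '' K, (hK.image continuous_snd).isClosed, ?_⟩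
  ext t
  constructor
  · rintro ⟨ht, hb⟩
    obtain ⟨s, hs, hv, -⟩ := h.exists_isGreatest_stageValue d ht
    refine ⟨ht, (s, t), ⟨⟨⟨X_subset_T ht hs, ?_⟩, ht⟩, fun i => (hs i).1, fun i => (hs i).2⟩, rfl⟩
    simpa [← hv] using hb
  · rintro ⟨ht, ⟨s, _⟩, ⟨⟨⟨_, hb⟩, _⟩, h0, hle⟩, rfl⟩
    obtain ⟨-, -, -, hv⟩ := h.exists_isGreatest_stageValue d ht
    exact ⟨ht, le_trans hb (hv s fun i => ⟨h0 i, hle i⟩)⟩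

/-- The expected profit of the reservation `t` under optimal execution. -/
noncomputable def reservationProfit (G : CapacityGame n 𝒟) (t : Fin n → ℝ) : ℝ :=
  (∫ d, G.stageValue d t ∂G.law) - ∑ i, G.E i t

theorem StandingAssumptions.upperSemicontinuousOn_reservationProfit
    (h : G.StandingAssumptions) : UpperSemicontinuousOn G.reservationProfit G.T := by
  refine upperSemicontinuousOn_sub_sum _ ?_ h.lowerSemicontinuous_E
  -- By monotonicity, the value at the largest reservation is the integrable majorant for Fatou.
  have htop : (fun _ => G.dbar) ∈ G.T := fun _ => ⟨h.dbar_nonneg, le_rfl⟩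
  exact upperSemicontinuousOn_integral (h.integrable_stageValue _ htop) h.integrable_stageValue
    (fun t ht d => h.stageValue_mono d ht htop fun i => (ht i).2)
    h.upperSemicontinuousOn_stageValue

/-- The reservations that use only the suppliers in `S`. -/
def restrictedReservations (G : CapacityGame n 𝒟) (S : Finset (Fin n)) : Set (Fin n → ℝ) :=
  {t | t ∈ G.T ∧ ∀ i ∉ S, t i = 0}

theorem isCompact_restrictedReservations (G : CapacityGame n 𝒟) (S : Finset (Fin n)) :
    IsCompact (G.restrictedReservations S) := by
  refine G.isCompact_T.inter_right (t := {t | ∀ i ∉ S, t i = 0}) ?_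
  have : {t : Fin n → ℝ | ∀ i ∉ S, t i = 0} = ⋂ i, ⋂ (_ : i ∉ S), {t | t i = 0} := by
    ext; simp
  rw [this]
  exact isClosed_iInter fun i => isClosed_iInter fun _ =>
    isClosed_eq (continuous_apply i) continuous_const

theorem StandingAssumptions.channelProfit_le (h : G.StandingAssumptions) {S : Finset (Fin n)}
    {t : Fin n → ℝ} {s : 𝒟 → Fin n → ℝ} (hp : G.IsPolicy S t s) :
    G.channelProfit t s ≤ G.reservationProfit t := by
  have := h.isProbabilityMeasure
  obtain ⟨ht, -, hs, hint⟩ := hp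
  have hv := h.integrable_stageValue t ht
  calc G.channelProfit t s ≤ ∫ d, (G.stageValue d t - ∑ i, G.E i t) ∂G.law := by
        refine integral_mono hint (hv.sub (integrable_const _)) fun d => ?_
        obtain ⟨-, -, -, hmax⟩ := h.exists_isGreatest_stageValue d ht
        have := hmax (s d) (hs d)
        simp only [realizedProfit, Finset.sum_add_distrib]
        linarith
    _ = G.reservationProfit t := by
        rw [integral_sub hv (integrable_const _)]; simp [reservationProfit]

/-- No measurable selection is needed: a policy only requires its realized profit to be integrable,
and for pointwise maximisers this is the stage value minus a constant. -/
theorem StandingAssumptions.reservationProfit_mem (h : G.StandingAssumptions)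
    {S : Finset (Fin n)} {t : Fin n → ℝ} (ht : t ∈ G.restrictedReservations S) :
    G.reservationProfit t ∈ G.attainableProfits S := by
  have := h.isProbabilityMeasure
  choose s hs hv _ using fun d => h.exists_isGreatest_stageValue d ht.1
  have hreal : (fun d => G.realizedProfit d t (s d)) =
      fun d => G.stageValue d t - ∑ i, G.E i t := by
    funext d
    simp only [realizedProfit, Finset.sum_add_distrib, hv]
    ring
  have hint := h.integrable_stageValue t ht.1
  refine ⟨t, s, ⟨ht.1, fun i hi => ?_, hs, ?_⟩, ?_⟩
  · by_contra hiS
    exact hi.ne' (ht.2 i hiS)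
  · rw [hreal]
    exact hint.sub (integrable_const _)
  · rw [channelProfit, hreal, integral_sub hint (integrable_const _)]
    simp [reservationProfit]

theorem StandingAssumptions.exists_optimal_reservation (h : G.StandingAssumptions)
    (S : Finset (Fin n)) :
    ∃ t ∈ G.restrictedReservations S, G.optProfit S = G.reservationProfit t ∧
      (∀ t' ∈ G.restrictedReservations S, G.reservationProfit t' ≤ G.optProfit S) ∧
      IsGreatest (G.attainableProfits S) (G.optProfit S) := by
  have h0 : (0 : Fin n → ℝ) ∈ G.T := fun _ => ⟨le_rfl, h.dbar_nonneg⟩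
  have husc : UpperSemicontinuousOn G.reservationProfit (G.restrictedReservations S) :=
    h.upperSemicontinuousOn_reservationProfit.mono fun t ht => ht.1
  have hne : (G.restrictedReservations S).Nonempty := ⟨0, h0, fun _ _ => rfl⟩
  obtain ⟨t, ht, hmax⟩ := husc.exists_isMaxOn hne
    (G.isCompact_restrictedReservations S)
  have hg : IsGreatest (G.attainableProfits S) (G.reservationProfit t) := by
    refine ⟨h.reservationProfit_mem ht, ?_⟩
    rintro _ ⟨t', s, hp, rfl⟩
    refine (h.channelProfit_le hp).trans (hmax ⟨hp.1, fun i hi => ?_⟩)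
    exact le_antisymm (not_lt.1 fun hlt => hi (hp.2.1 i hlt)) (hp.1 i).1
  have heq : G.optProfit S = G.reservationProfit t := hg.csSup_eq
  exact ⟨t, ht, heq, fun t' ht' => heq ▸ hmax ht', heq ▸ hg⟩

/-! ### Submodularity of the optimal profit -/

theorem mem_T_of_split {x y w : Fin n → ℝ} (hx : x ∈ G.T) (hy : y ∈ G.T)
    (hw : ∀ k, w k ∈ Set.uIcc 0 (x k - y k)) : y + w ∈ G.T ∧ x - w ∈ G.T := by
  refine ⟨fun k => ?_, fun k => ?_⟩ <;>
  · obtain ⟨hx0, hx1⟩ := hx k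
    obtain ⟨hy0, hy1⟩ := hy k
    rcases Set.mem_uIcc.1 (hw k) with ⟨h1, h2⟩ | ⟨h1, h2⟩ <;>
    constructor <;> simp only [Pi.add_apply, Pi.sub_apply] <;> linarith

/-- `ConcaveOn.add_le_add_of_mem_uIcc` applies term by term: to `g_A` with shift `w(A)`, and to
`-E_i` with shift `w i`. -/
theorem reservationProfit_add_le (h : G.StandingAssumptions) (hE : G.ReservationCostsConvex)
    {L : Finset (Finset (Fin n))} (hL : ∀ d, LaminarConcaveOn L G.T (G.stageValue d))
    {x y w : Fin n → ℝ} (hx : x ∈ G.T) (hy : y ∈ G.T)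
    (hwk : ∀ k, w k ∈ Set.uIcc 0 (x k - y k))
    (hw : ∀ A ∈ L, partialSum A w ∈ Set.uIcc 0 (partialSum A (x - y))) :
    G.reservationProfit x + G.reservationProfit y ≤
      G.reservationProfit (y + w) + G.reservationProfit (x - w) := by
  obtain ⟨hyw, hxw⟩ := mem_T_of_split hx hy hwk
  have hstage : (∫ d, G.stageValue d x ∂G.law) + ∫ d, G.stageValue d y ∂G.law ≤
      (∫ d, G.stageValue d (y + w) ∂G.law) + ∫ d, G.stageValue d (x - w) ∂G.law := by
    have hi := h.integrable_stageValue
    rw [← integral_add (hi x hx) (hi y hy), ← integral_add (hi _ hyw) (hi _ hxw)]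
    refine integral_mono ((hi x hx).add (hi y hy)) ((hi _ hyw).add (hi _ hxw)) fun d => ?_
    obtain ⟨g, hg, hf⟩ := hL d
    simp only [hf x hx, hf y hy, hf _ hyw, hf _ hxw, ← Finset.sum_add_distrib]
    refine Finset.sum_le_sum fun A hA => ?_
    have := hw A hA
    rw [partialSum_sub] at this
    rw [partialSum_add, partialSum_sub]
    exact (hg A hA).add_le_add_of_mem_uIcc ⟨x, hx, rfl⟩ ⟨y, hy, rfl⟩ this
  have hcost : ∑ i, G.E i (y + w) + ∑ i, G.E i (x - w) ≤ ∑ i, G.E i x + ∑ i, G.E i y := by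
    simp only [← Finset.sum_add_distrib]
    refine Finset.sum_le_sum fun i _ => ?_
    obtain ⟨φ, hφ, hEφ⟩ := hE i
    rw [hEφ x hx, hEφ y hy, hEφ _ hyw, hEφ _ hxw]
    have := hφ.neg.add_le_add_of_mem_uIcc (hx i) (hy i) (hwk i)
    simp only [Pi.neg_apply, Pi.add_apply, Pi.sub_apply] at this ⊢
    linarith
  simp only [reservationProfit]
  linarith

theorem isLaminar_union_singletons {L : Finset (Finset (Fin n))} (hL : IsLaminarFamily L) :
    ∀ A ∈ L ∪ Finset.univ.image (fun k : Fin n => ({k} : Finset (Fin n))),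
      ∀ B ∈ L ∪ Finset.univ.image (fun k : Fin n => ({k} : Finset (Fin n))),
        A ∩ B = ∅ ∨ A ⊆ B ∨ B ⊆ A := by
  intro A hA B hB
  simp only [Finset.mem_union, Finset.mem_image, Finset.mem_univ, true_and] at hA hB
  rcases hA with hA | ⟨k, rfl⟩
  · rcases hB with hB | ⟨k, rfl⟩
    · exact hL.2 A hA B hB
    · by_cases hk : k ∈ A
      · exact Or.inr (Or.inr (by simpa using hk))
      · exact Or.inl (Finset.inter_singleton_of_notMem hk)
  · by_cases hk : k ∈ B
    · exact Or.inr (Or.inl (by simpa using hk))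
    · exact Or.inl (Finset.singleton_inter_of_notMem hk)

theorem isSubmodular_optProfit (h : G.StandingAssumptions) (hv : G.StageValueLaminarConcave)
    (hE : G.ReservationCostsConvex) : IsSubmodular G.optProfit := by
  intro S i j hi hj hij
  obtain ⟨L, hL, hLv⟩ := hv
  obtain ⟨x, hx, hxopt, -, -⟩ := h.exists_optimal_reservation S
  obtain ⟨y, hy, hyopt, -, -⟩ := h.exists_optimal_reservation (S \ {i, j})
  have hyi : y i = 0 := hy.2 i (by simp)
  have hyj : y j = 0 := hy.2 j (by simp)
  obtain ⟨w, hwi, hwj, hw⟩ := exists_laminar_split (isLaminar_union_singletons hL)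
    (fun k => by simp) (x - y) hij (by simpa [hyi] using (hx.1 i).1)
    (by simpa [hyj] using (hx.1 j).1)
  have hwk (k : Fin n) : w k ∈ Set.uIcc 0 (x k - y k) := by
    simpa [partialSum_singleton] using hw {k} (by simp)
  obtain ⟨hyw, hxw⟩ := mem_T_of_split hx.1 hy.1 hwk
  have key := reservationProfit_add_le h hE hLv hx.1 hy.1 hwk
    fun A hA => hw A (Finset.mem_union_left _ hA)
  -- Outside `S` the interval allowed for `w k` collapses to `0`.
  have hout (k : Fin n) (hk : k ∉ S) : x k = 0 ∧ y k = 0 ∧ w k = 0 := by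
    have hxk := hx.2 k hk
    have hyk := hy.2 k (by simp [hk])
    have := hwk k
    simp only [hxk, hyk, sub_zero, Set.uIcc_self, Set.mem_singleton_iff] at this
    exact ⟨hxk, hyk, this⟩
  obtain ⟨-, -, -, hmaxi, -⟩ := h.exists_optimal_reservation (S \ {i})
  obtain ⟨-, -, -, hmaxj, -⟩ := h.exists_optimal_reservation (S \ {j})
  have h1 := hmaxi (y + w) ⟨hyw, fun k hk => by
    by_cases hkS : k ∈ S
    · have : k = i := by simpa [hkS] using hk
      simp [this, hyi, hwi]
    · simp [hout k hkS]⟩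
  have h2 := hmaxj (x - w) ⟨hxw, fun k hk => by
    by_cases hkS : k ∈ S
    · have : k = j := by simpa [hkS] using hk
      simp [this, hyj, hwj]
    · simp [hout k hkS]⟩
  linarith

end CapacityGame

/-! ### Convex primitives, and sums indexed with repetitions -/

/-- The primitive of a monotone function is convex. -/
theorem MonotoneOn.convexOn_primitive {e : ℝ → ℝ} {b : ℝ} (he : MonotoneOn e (Set.Icc 0 b)) :
    ConvexOn ℝ (Set.Icc 0 b) fun x => ∫ u in (0 : ℝ)..x, e u := by
  have hint {x y : ℝ} (hx : x ∈ Set.Icc 0 b) (hy : y ∈ Set.Icc 0 b) :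
      IntervalIntegrable e volume x y :=
    (he.mono ((convex_Icc 0 b).ordConnected.uIcc_subset hx hy)).intervalIntegrable
  refine convexOn_of_slope_mono_adjacent (convex_Icc 0 b) fun {x y z} hx hz hxy hyz => ?_
  have hy : y ∈ Set.Icc 0 b := ⟨hx.1.trans hxy.le, hyz.le.trans hz.2⟩
  have h0 : (0 : ℝ) ∈ Set.Icc 0 b := ⟨le_rfl, hx.1.trans hx.2⟩
  rw [intervalIntegral.integral_interval_sub_left (hint h0 hy) (hint h0 hx),
    intervalIntegral.integral_interval_sub_left (hint h0 hz) (hint h0 hy)]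
  -- The value `e y` separates the slopes on the two sides of `y`.
  have h1 : ∫ u in x..y, e u ≤ ∫ _ in x..y, e y :=
    intervalIntegral.integral_mono_on hxy.le (hint hx hy) intervalIntegrable_const fun u hu =>
      he ⟨hx.1.trans hu.1, hu.2.trans hy.2⟩ hy hu.2
  have h2 : ∫ _ in y..z, e y ≤ ∫ u in y..z, e u :=
    intervalIntegral.integral_mono_on hyz.le intervalIntegrable_const (hint hy hz) fun u hu =>
      he hy ⟨hy.1.trans hu.1, hu.2.trans hz.2⟩ hu.1
  simp only [intervalIntegral.integral_const, smul_eq_mul] at h1 h2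
  calc (∫ u in x..y, e u) / (y - x) ≤ e y := by
        rw [div_le_iff₀ (sub_pos.2 hxy)]; linarith
    _ ≤ (∫ u in y..z, e u) / (z - y) := by
        rw [le_div_iff₀ (sub_pos.2 hyz)]; linarith

/-- A sum of concave functions of partial sums over members of a family, possibly with
repetitions, is laminar concave. -/
theorem laminarConcaveOn_of_indexed_sum {n : ℕ} {ι : Type*} {L : Finset (Finset (Fin n))}
    {T : Set (Fin n → ℝ)} (hT : Convex ℝ T) {f : (Fin n → ℝ) → ℝ} (I : Finset ι)
    (A : ι → Finset (Fin n)) (hA : ∀ l ∈ I, A l ∈ L) (g : ι → ℝ → ℝ)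
    (hg : ∀ l ∈ I, ConcaveOn ℝ Set.univ (g l))
    (hf : ∀ x ∈ T, f x = ∑ l ∈ I, g l (partialSum (A l) x)) : LaminarConcaveOn L T f := by
  classical
  -- Members hit by several indices collect all their summands; members hit by none get `0`.
  refine ⟨fun B y => ∑ l ∈ I with A l = B, g l y, fun B _ => ?_, fun x hx => ?_⟩
  · have hconv : Convex ℝ (partialSum B '' T) := by
      refine hT.is_linear_image ⟨partialSum_add B, fun c x => ?_⟩
      simp [partialSum, Finset.mul_sum]
    have hsum (J : Finset ι) (hJ : J ⊆ I) :
        ConcaveOn ℝ Set.univ fun y => ∑ l ∈ J, g l y := by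
      induction J using Finset.induction_on with
      | empty => simpa using concaveOn_const (0 : ℝ) convex_univ
      | insert l J hl ih =>
        simp only [Finset.sum_insert hl]
        exact (hg l (hJ (Finset.mem_insert_self l J))).add
          (ih ((Finset.subset_insert l J).trans hJ))
    exact (hsum _ (Finset.filter_subset _ _)).subset (Set.subset_univ _) hconv
  · rw [hf x hx, ← Finset.sum_fiberwise_of_maps_to hA]
    refine Finset.sum_congr rfl fun B _ => Finset.sum_congr rfl fun l hl => ?_
    rw [(Finset.mem_filter.1 hl).2]

/-! ### Greedy execution -/

/-- The elements whose rank under `r` is less than `l`. -/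
def prefixSet {n : ℕ} (r : Equiv.Perm (Fin n)) (l : ℕ) : Finset (Fin n) :=
  Finset.univ.filter fun i => (r i : ℕ) < l

theorem prefixSet_mono {n : ℕ} (r : Equiv.Perm (Fin n)) {l l' : ℕ} (h : l ≤ l') :
    prefixSet r l ⊆ prefixSet r l' := by
  intro i hi
  simp only [prefixSet, Finset.mem_filter, Finset.mem_univ, true_and] at hi ⊢
  omega

theorem partialSum_prefixSet_zero {n : ℕ} (r : Equiv.Perm (Fin n)) (x : Fin n → ℝ) :
    partialSum (prefixSet r 0) x = 0 := by
  simp [partialSum, prefixSet]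

theorem partialSum_prefixSet_succ {n : ℕ} (r : Equiv.Perm (Fin n)) (x : Fin n → ℝ) (i : Fin n) :
    partialSum (prefixSet r (r i + 1)) x = partialSum (prefixSet r (r i)) x + x i := by
  have : prefixSet r (r i + 1) = insert i (prefixSet r (r i)) := by
    ext k
    simp only [prefixSet, Finset.mem_filter, Finset.mem_univ, true_and, Finset.mem_insert,
      Nat.lt_succ_iff, le_iff_eq_or_lt, ← Fin.ext_iff, r.injective.eq_iff]
  rw [partialSum, this, Finset.sum_insert (by simp [prefixSet]), add_comm, partialSum]

/-- The prefixes form a chain. Including the empty prefix keeps the family non-empty even for `n =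
0`. -/
theorem isLaminarFamily_prefixSet {n : ℕ} (r : Equiv.Perm (Fin n)) :
    IsLaminarFamily ((Finset.range (n + 1)).image (prefixSet r)) := by
  refine ⟨⟨_, Finset.mem_image_of_mem _ (Finset.mem_range.2 n.succ_pos)⟩, ?_⟩
  intro A hA B hB
  obtain ⟨l, -, rfl⟩ := Finset.mem_image.1 hA
  obtain ⟨l', -, rfl⟩ := Finset.mem_image.1 hB
  exact Or.inr ((le_total l l').imp (prefixSet_mono r) (prefixSet_mono r))

theorem sum_perm_eq_sum_range {n : ℕ} (r : Equiv.Perm (Fin n)) (q : ℕ → ℝ) :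
    ∑ i, q (r i) = ∑ l ∈ Finset.range n, q l := by
  rw [Equiv.sum_comp r fun i : Fin n => q i, Fin.sum_univ_eq_sum_range]

theorem sum_range_mul_sub {a P : ℕ → ℝ} (hP : P 0 = 0) (n : ℕ) :
    ∑ l ∈ Finset.range n, a l * (P (l + 1) - P l) =
      ∑ l ∈ Finset.range n, (a l - a (l + 1)) * P (l + 1) + a n * P n := by
  induction n with
  | zero => simp [hP]
  | succ n ih => rw [Finset.sum_range_succ, Finset.sum_range_succ, ih]; ring

/-- A non-negative vector has a ranking in decreasing order. -/
theorem exists_antitone_ranking {n : ℕ} (m : Fin n → ℝ) (hm : ∀ i, 0 ≤ m i) :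
    ∃ (r : Equiv.Perm (Fin n)) (a : ℕ → ℝ), Antitone a ∧ a n = 0 ∧ ∀ i, m i = a (r i) := by
  let σ := Tuple.sort fun i => -m i
  have hσ : Antitone (m ∘ σ) := fun i j hij => by
    simpa using Tuple.monotone_sort (fun i => -m i) hij
  -- The default `0` preserves monotonicity because `m ≥ 0`, and it kills the boundary term of the
  -- summation by parts.
  refine ⟨σ.symm, fun l => if h : l < n then m (σ ⟨l, h⟩) else 0, ?_, by simp, by simp⟩
  intro l l' hll'
  by_cases h' : l' < n
  · have h : l < n := hll'.trans_lt h'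
    simp only [h, h', dif_pos]
    exact hσ (Fin.mk_le_mk.2 hll')
  · by_cases h : l < n
    · simp only [h, h', dif_pos, dif_neg, not_false_eq_true]
      exact hm _
    · simp [h, h']

/-- The value of the greedy execution, which uses the suppliers in the order of their ranks. -/
noncomputable def greedyValue {n : ℕ} (r : Equiv.Perm (Fin n)) (a : ℕ → ℝ) (d : ℝ)
    (t : Fin n → ℝ) : ℝ :=
  ∑ l ∈ Finset.range n, (a l - a (l + 1)) * min d (partialSum (prefixSet r (l + 1)) t)

/-- With linear execution costs, the optimal second stage value is the greedy value. -/
theorem isGreatest_greedyValue {n : ℕ} {r : Equiv.Perm (Fin n)} {a : ℕ → ℝ} (ha : Antitone a)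
    (han : a n = 0) {ρ : ℝ} {k : Fin n → ℝ} (hk : ∀ i, 0 ≤ k i)
    (hm : ∀ i, max (ρ - k i) 0 = a (r i)) {d : ℝ} (hd : 0 ≤ d) {t : Fin n → ℝ}
    (ht : ∀ i, 0 ≤ t i) :
    IsGreatest ((fun s : Fin n → ℝ => ρ * min d (∑ i, s i) - ∑ i, k i * s i) ''
      {s | ∀ i, 0 ≤ s i ∧ s i ≤ t i}) (greedyValue r a d t) := by
  have hP0 (x : Fin n → ℝ) := partialSum_prefixSet_zero r x
  have hPs (x : Fin n → ℝ) (i : Fin n) := partialSum_prefixSet_succ r x i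
  constructor
  · let P : ℕ → ℝ := fun l => min d (partialSum (prefixSet r l) t)
    have hPzero : P 0 = 0 := by simp [P, hP0, hd]
    have hmono (i : Fin n) : P (r i) ≤ P (r i + 1) :=
      min_le_min le_rfl (by rw [hPs]; linarith [ht i])
    have hstep (i : Fin n) : P (r i + 1) - P (r i) ≤ t i := by
      have h1 : P (r i + 1) ≤ d := min_le_left _ _
      have h2 : P (r i + 1) ≤ partialSum (prefixSet r (r i)) t + t i := by
        rw [← hPs]; exact min_le_right _ _
      have : P (r i + 1) - t i ≤ P (r i) := le_min (by linarith [ht i]) (by linarith)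
      linarith
    -- `P l` is the demand that the first `l` suppliers can serve; each supplier with a positive
    -- margin executes its increment.
    let s : Fin n → ℝ := fun i => if 0 < a (r i) then P (r i + 1) - P (r i) else 0
    have hs (i : Fin n) : 0 ≤ s i ∧ s i ≤ P (r i + 1) - P (r i) := by
      simp only [s]
      split_ifs
      · exact ⟨by linarith [hmono i], le_rfl⟩
      · exact ⟨le_rfl, by linarith [hmono i]⟩
    refine ⟨s, fun i => ⟨(hs i).1, (hs i).2.trans (hstep i)⟩, ?_⟩
    have hsum : ∑ i, s i ≤ d := by
      calc ∑ i, s i ≤ ∑ i, (P (r i + 1) - P (r i)) := Finset.sum_le_sum fun i _ => (hs i).2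
        _ = P n := by
          rw [sum_perm_eq_sum_range r fun l => P (l + 1) - P l, Finset.sum_range_sub, hPzero,
            sub_zero]
        _ ≤ d := min_le_left _ _
    have hterm (i : Fin n) : (ρ - k i) * s i = a (r i) * (P (r i + 1) - P (r i)) := by
      simp only [s]
      split_ifs with h
      · rw [← hm i] at h ⊢
        rw [max_eq_left]
        exact (lt_max_iff.1 h).elim le_of_lt fun h => absurd h (lt_irrefl _)
      · have : a (r i) = 0 := le_antisymm (not_lt.1 h) (hm i ▸ le_max_right _ _)
        simp [this]
    calc ρ * min d (∑ i, s i) - ∑ i, k i * s i = ∑ i, (ρ - k i) * s i := by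
          rw [min_eq_right hsum, Finset.mul_sum, ← Finset.sum_sub_distrib]
          exact Finset.sum_congr rfl fun i _ => by ring
      _ = ∑ l ∈ Finset.range n, a l * (P (l + 1) - P l) := by
          simp only [hterm]
          exact sum_perm_eq_sum_range r fun l => a l * (P (l + 1) - P l)
      _ = greedyValue r a d t := by
          rw [sum_range_mul_sub hPzero, han, zero_mul, add_zero, greedyValue]
  · rintro _ ⟨s, hs, rfl⟩
    have hS : 0 ≤ ∑ i, s i := Finset.sum_nonneg fun i _ => (hs i).1
    -- Scaling `s` down to the quantity sold keeps the revenue and, as `k ≥ 0`, does not raise the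
    -- cost; the profit becomes linear.
    obtain ⟨θ, hθ0, hθ1, hθ⟩ : ∃ θ : ℝ, 0 ≤ θ ∧ θ ≤ 1 ∧ θ * ∑ i, s i = min d (∑ i, s i) := by
      by_cases h : ∑ i, s i ≤ d
      · exact ⟨1, zero_le_one, le_rfl, by rw [min_eq_right h, one_mul]⟩
      · push Not at h
        have hpos : 0 < ∑ i, s i := hd.trans_lt h
        exact ⟨d / ∑ i, s i, div_nonneg hd hS, (div_le_one hpos).2 h.le,
          by rw [min_eq_left h.le, div_mul_cancel₀ _ hpos.ne']⟩
    let s' : Fin n → ℝ := fun i => θ * s i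
    have hs'0 (i : Fin n) : 0 ≤ s' i := mul_nonneg hθ0 (hs i).1
    have hs's (i : Fin n) : s' i ≤ s i := mul_le_of_le_one_left (hs i).1 hθ1
    have hsum : ∑ i, s' i = min d (∑ i, s i) := by rw [← hθ, Finset.mul_sum]
    calc ρ * min d (∑ i, s i) - ∑ i, k i * s i ≤ ∑ i, (ρ - k i) * s' i := by
          rw [← hsum, Finset.mul_sum, ← Finset.sum_sub_distrib]
          exact Finset.sum_le_sum fun i _ => by
            linarith [mul_le_mul_of_nonneg_left (hs's i) (hk i)]
      _ ≤ ∑ i, a (r i) * (partialSum (prefixSet r (r i + 1)) s' -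
            partialSum (prefixSet r (r i)) s') := by
          refine Finset.sum_le_sum fun i _ => ?_
          rw [hPs, add_sub_cancel_left, ← hm i]
          exact mul_le_mul_of_nonneg_right (le_max_left _ _) (hs'0 i)
      _ = ∑ l ∈ Finset.range n, (a l - a (l + 1)) * partialSum (prefixSet r (l + 1)) s' := by
          rw [sum_perm_eq_sum_range r fun l => a l * (partialSum (prefixSet r (l + 1)) s' -
            partialSum (prefixSet r l) s'),
            sum_range_mul_sub (P := fun l => partialSum (prefixSet r l) s') (hP0 s'), han,
            zero_mul, add_zero]
      -- The weights are non-negative, and each prefix sum of `s'` is at most `d` and at most that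
      -- of `t`.
      _ ≤ greedyValue r a d t := by
          refine Finset.sum_le_sum fun l _ => mul_le_mul_of_nonneg_left (le_min ?_ ?_)
            (sub_nonneg.2 (ha l.le_succ))
          · calc partialSum (prefixSet r (l + 1)) s' ≤ ∑ i, s' i :=
                  Finset.sum_le_sum_of_subset_of_nonneg (Finset.subset_univ _)
                    fun i _ _ => hs'0 i
              _ ≤ d := hsum ▸ min_le_left _ _
          · exact Finset.sum_le_sum fun i _ => (hs's i).trans (hs i).2

/-! ### The capacity game with function bids -/

namespace FunctionBidGame

variable {n : ℕ} (B : FunctionBidGame n)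

theorem dbar_pos : 0 < B.dbar := B.dlow_nonneg.trans_lt B.dlow_lt_dbar

variable {B} {k : Fin n → ℝ}

theorem C_eq_mul (hk : ∀ i, ∀ u ∈ Set.Icc 0 B.dbar, B.c i u = k i) (i : Fin n) {s : Fin n → ℝ}
    (hs : s ∈ B.toCapacityGame.T) : B.toCapacityGame.C i s = k i * s i := by
  have : ∫ u in (0 : ℝ)..(s i), B.c i u = ∫ _ in (0 : ℝ)..(s i), k i := by
    refine intervalIntegral.integral_congr fun u hu => ?_
    rw [Set.uIcc_of_le (hs i).1] at hu
    exact hk i u ⟨hu.1, hu.2.trans (hs i).2⟩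
  simp only [toCapacityGame]
  rw [this, intervalIntegral.integral_const, sub_zero, smul_eq_mul, mul_comm]

/-- Constant marginal execution costs give the greedy value as second stage value. -/
theorem exists_stageValue_eq_greedyValue
    (hc : ∀ i, ∃ k : ℝ, ∀ u ∈ Set.Icc 0 B.dbar, B.c i u = k) :
    ∃ (r : Equiv.Perm (Fin n)) (a : ℕ → ℝ), Antitone a ∧
      ∀ d, ∀ t ∈ B.toCapacityGame.T,
        B.toCapacityGame.stageValue d t = greedyValue r a (d : ℝ) t := by
  choose k hk using hc
  have hk0 (i : Fin n) : 0 ≤ k i := by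
    have h0 : (0 : ℝ) ∈ Set.Icc 0 B.dbar := ⟨le_rfl, B.dbar_pos.le⟩
    rw [← hk i 0 h0]
    exact B.c_nonneg i 0 h0
  -- The ranking depends on the margins only, not on `d` or `t`; hence one laminar family serves all
  -- demands.
  obtain ⟨r, a, ha, han, hm⟩ := exists_antitone_ranking (fun i => max (B.ρ - k i) 0)
    fun i => le_max_right _ _
  refine ⟨r, a, ha, fun d t ht => ?_⟩
  rw [CapacityGame.stageValue, Set.image_congr fun s hs => ?_]
  · exact (isGreatest_greedyValue ha han hk0 hm (B.dlow_nonneg.trans d.2.1)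
      fun i => (ht i).1).csSup_eq
  · have hsT := CapacityGame.X_subset_T ht hs
    simp only [C_eq_mul hk _ hsT]
    rfl

theorem standingAssumptions (hc : ∀ i, ∃ k : ℝ, ∀ u ∈ Set.Icc 0 B.dbar, B.c i u = k) :
    B.toCapacityGame.StandingAssumptions where
  isProbabilityMeasure := B.isProbabilityMeasure
  dbar_nonneg := B.dbar_pos.le
  C_eq_zero := fun i s _ h => by simp [toCapacityGame, h]
  E_eq_zero := fun i s _ h => by simp [toCapacityGame, h]
  upperSemicontinuous_V := fun d => by
    have : Continuous fun s : Fin n → ℝ => B.ρ * min (d : ℝ) (∑ i, s i) := by fun_prop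
    exact this.upperSemicontinuous.upperSemicontinuousOn _
  lowerSemicontinuous_C := fun i => by
    choose k hk using hc
    have h : Continuous fun s : Fin n → ℝ => k i * s i := by fun_prop
    exact (h.continuousOn.congr fun s hs => C_eq_mul hk i hs).lowerSemicontinuousOn
  lowerSemicontinuous_E := fun i => by
    have h : ContinuousOn (fun x => ∫ u in (0 : ℝ)..x, B.e i u) (Set.uIcc 0 B.dbar) := by
      refine intervalIntegral.continuousOn_primitive_interval ?_
      rw [Set.uIcc_of_le B.dbar_pos.le]
      exact (intervalIntegrable_iff_integrableOn_Icc_of_le B.dbar_pos.le).1 (B.e_integrable i)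
    rw [Set.uIcc_of_le B.dbar_pos.le] at h
    have hmaps : Set.MapsTo (fun t : Fin n → ℝ => t i) B.toCapacityGame.T (Set.Icc 0 B.dbar) :=
      fun t ht => ht i
    exact (h.comp (continuous_apply i).continuousOn hmaps).lowerSemicontinuousOn
  integrable_stageValue := fun t ht => by
    obtain ⟨r, a, -, h⟩ := exists_stageValue_eq_greedyValue hc
    simp only [h _ t ht, greedyValue]
    have := B.isProbabilityMeasure
    have hcont : Continuous fun d : Set.Icc B.dlow B.dbar => ∑ l ∈ Finset.range n,
        (a l - a (l + 1)) * min (d : ℝ) (partialSum (prefixSet r (l + 1)) t) := by fun_prop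
    exact hcont.integrable_of_hasCompactSupport (μ := B.law) (HasCompactSupport.of_compactSpace _)

theorem stageValueLaminarConcave
    (hc : ∀ i, ∃ k : ℝ, ∀ u ∈ Set.Icc 0 B.dbar, B.c i u = k) :
    B.toCapacityGame.StageValueLaminarConcave := by
  obtain ⟨r, a, ha, h⟩ := exists_stageValue_eq_greedyValue hc
  refine ⟨_, isLaminarFamily_prefixSet r, fun d => ?_⟩
  refine laminarConcaveOn_of_indexed_sum (I := Finset.range n)
    (A := fun l => prefixSet r (l + 1)) (g := fun l y => (a l - a (l + 1)) * min (d : ℝ) y)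
    ?_ (fun l hl => Finset.mem_image_of_mem _ ?_) (fun l _ => ?_) fun t ht => h d t ht
  · rw [CapacityGame.T_eq_Icc]
    exact convex_Icc _ _
  · simpa using hl
  · exact ((concaveOn_const (d : ℝ) convex_univ).inf (concaveOn_id convex_univ)).smul
      (sub_nonneg.2 (ha l.le_succ))

theorem reservationCostsConvex (he : ∀ i, MonotoneOn (B.e i) (Set.Icc 0 B.dbar)) :
    B.toCapacityGame.ReservationCostsConvex :=
  fun i => ⟨_, (he i).convexOn_primitive, fun _ _ => rfl⟩

end FunctionBidGame

theorem theorem3 (n : ℕ) :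
    (∀ (𝒟 : Type*) [MeasurableSpace 𝒟] (G : CapacityGame n 𝒟),
      G.StandingAssumptions → G.StageValueLaminarConcave → G.ReservationCostsConvex →
        (∀ S, IsGreatest (G.attainableProfits S) (G.optProfit S)) ∧ IsSubmodular G.optProfit) ∧
    (∀ B : FunctionBidGame n,
      (∀ i, ∃ k : ℝ, ∀ u ∈ Set.Icc 0 B.dbar, B.c i u = k) →
      (∀ i, MonotoneOn (B.e i) (Set.Icc 0 B.dbar)) →
        B.toCapacityGame.StandingAssumptions ∧
        B.toCapacityGame.StageValueLaminarConcave ∧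
        B.toCapacityGame.ReservationCostsConvex ∧
        (∀ S, IsGreatest (B.toCapacityGame.attainableProfits S) (B.toCapacityGame.optProfit S)) ∧
        IsSubmodular B.toCapacityGame.optProfit) := by
  refine ⟨fun 𝒟 _ G h hv hE => ⟨fun S => ?_, CapacityGame.isSubmodular_optProfit h hv hE⟩,
    fun B hc he => ?_⟩
  · obtain ⟨-, -, -, -, hg⟩ := h.exists_optimal_reservation S
    exact hg
  · have h := FunctionBidGame.standingAssumptions hc
    have hv := FunctionBidGame.stageValueLaminarConcave hc
    have hE := FunctionBidGame.reservationCostsConvex he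
    refine ⟨h, hv, hE, fun S => ?_, CapacityGame.isSubmodular_optProfit h hv hE⟩
    obtain ⟨-, -, -, -, hg⟩ := h.exists_optimal_reservation S
    exact hg
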